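/- Let $d\ge 1$, and let $\Omega\subset\mathbb{R}^d$ be either a bounded open set with smooth ($C^\infty$) boundary or $\Omega=\mathbb{R}^d$. Put $\gamma_d=\int_{\mathbb{S}^{d-1}}|\sigma\cdot e|\,d\sigma$ for a unit vector $e\in\mathbb{R}^d$ (the value does not depend on $e$). Let $\mathcal{A}$ be the set of functions $\varphi:[0,\infty)\to[0,\infty)$ such that - $\varphi$ is continuous on $[0,\infty)$ except at finitely many points of $(0,\infty)$, where it has limits from the left and from the right; $\varphi(0)=0$, and $\varphi(t)=\min\{\varphi(t+),\varphi(t-)\}$ for all $t>0$; - $\varphi(t)\le a t^2$ for all $t\in[0,1]$, for some constant $a>0$; - $\varphi(t)\le b$ for all $t\ge 0$, for some constant $b>0$; - $\varphi$ is non-decreasing; - $\gamma_d\int_0^\infty \varphi(t)\,t^{-2}\,dt=1$. For a measurable $u:\Omega\to\mathbb{R}$ and $\delta>0$ set $$\Lambda_\delta(u)=\int_\Omega\int_\Omega\frac{\delta\,\varphi(|u(x)-u(y)|/\delta)}{|x-y|^{d+1}}\,dx\,dy\in[0,+\infty].$$ For $u\in L^1(\Omega)$ let $\int_\Omega|\nabla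 u|\in[0,+\infty]$ denote the total variation of $u$, that is, the supremum of $\int_\Omega u\,\mathrm{div}\,\psi\,dx$ over all $\psi\in C^1_c(\Omega;\mathbb{R}^d)$ with $|\psi|\le 1$ everywhere; thus $\int_\Omega|\nabla u|=+\infty$ if $u\in L^1(\Omega)\setminus BV(\Omega)$. Then, for every $\varphi\in\mathcal{A}$ and every $u\in L^1(\Omega)$, $$\limsup_{\delta\to 0^+}\Lambda_\delta(u)\ \ge\ \int_\Omega|\nabla u|.$$ -/

import Mathlib

open Set Filter Topology MeasureTheory
open scoped ENNReal ContDiff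

noncomputable section

/-- The integral of `|σ · e|` over the unit sphere of `ℝ^d` with respect to the surface measure.
For unit vectors `e` it does not depend on `e`, and is the constant `γ_d`. -/
def sphereConst (d : ℕ) (e : EuclideanSpace ℝ (Fin d)) : ℝ :=
  ∫ σ : Metric.sphere (0 : EuclideanSpace ℝ (Fin d)) 1,
    |inner ℝ (σ : EuclideanSpace ℝ (Fin d)) e|
      ∂((volume : Measure (EuclideanSpace ℝ (Fin d))).toSphere)

/-- The class `𝒜` of profiles `φ : [0, ∞) → [0, ∞)` (in dimension `d`). Such a profile is given as
a function on `ℝ` of which only the values on `[0, ∞)` matter. -/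
structure IsProfile (d : ℕ) (φ : ℝ → ℝ) : Prop where
  /-- `φ` takes values in `[0, ∞)` -/
  nonneg : ∀ t, 0 ≤ t → 0 ≤ φ t
  /-- `φ` is continuous on `[0, ∞)` except at finitely many points of `(0, ∞)` -/
  continuous_off_finite : ∃ S : Finset ℝ, (∀ t ∈ S, 0 < t) ∧
    ∀ t, 0 ≤ t → t ∉ S → ContinuousWithinAt φ (Ici 0) t
  map_zero : φ 0 = 0
  /-- the one-sided limits exist, and `φ(t) = min {φ(t+), φ(t-)}` -/
  eq_min_limits : ∀ t, 0 < t → ∃ r l : ℝ,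
    Tendsto φ (𝓝[>] t) (𝓝 r) ∧ Tendsto φ (𝓝[<] t) (𝓝 l) ∧ φ t = min r l
  le_quadratic : ∃ a : ℝ, 0 < a ∧ ∀ t ∈ Icc (0 : ℝ) 1, φ t ≤ a * t ^ 2
  bounded : ∃ b : ℝ, 0 < b ∧ ∀ t, 0 ≤ t → φ t ≤ b
  monotone : MonotoneOn φ (Ici 0)
  /-- `γ_d ∫_0^∞ φ(t) t^{-2} dt = 1` (this forces the integral to converge) -/
  normalized : ∃ e : EuclideanSpace ℝ (Fin d), ‖e‖ = 1 ∧
    sphereConst d e * ∫ t in Ioi (0 : ℝ), φ t / t ^ 2 = 1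

/-- The boundary of `Ω` is smooth: near each of its boundary points, `Ω` is the set where
a `C^∞` function with nowhere vanishing differential is negative. -/
def HasSmoothBoundary {d : ℕ} (Ω : Set (EuclideanSpace ℝ (Fin d))) : Prop :=
  ∀ p ∈ frontier Ω, ∃ (U : Set (EuclideanSpace ℝ (Fin d))) (ρ : EuclideanSpace ℝ (Fin d) → ℝ),
    IsOpen U ∧ p ∈ U ∧ ContDiffOn ℝ ∞ ρ U ∧ (∀ x ∈ U, fderiv ℝ ρ x ≠ 0) ∧
      Ω ∩ U = {x ∈ U | ρ x < 0}

/-- `Λ(u) = ∫_Ω ∫_Ω φ(|u(x) - u(y)|) / |x - y|^{d+1} dx dy`, with values in `[0, ∞]`. -/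
def nonlocalEnergy {d : ℕ} (φ : ℝ → ℝ) (Ω : Set (EuclideanSpace ℝ (Fin d)))
    (u : EuclideanSpace ℝ (Fin d) → ℝ) : ℝ≥0∞ :=
  ∫⁻ x in Ω, ∫⁻ y in Ω, ENNReal.ofReal (φ |u x - u y| / ‖x - y‖ ^ (d + 1))

/-- `Λ_δ(u) = δ Λ(u / δ)`. -/
def scaledEnergy {d : ℕ} (φ : ℝ → ℝ) (Ω : Set (EuclideanSpace ℝ (Fin d))) (δ : ℝ)
    (u : EuclideanSpace ℝ (Fin d) → ℝ) : ℝ≥0∞ :=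
  ENNReal.ofReal δ * nonlocalEnergy φ Ω (fun x => u x / δ)

/-- The divergence of a vector field on `ℝ^d`. -/
def divergence {d : ℕ} (ψ : EuclideanSpace ℝ (Fin d) → EuclideanSpace ℝ (Fin d))
    (x : EuclideanSpace ℝ (Fin d)) : ℝ :=
  ∑ i, fderiv ℝ ψ x (EuclideanSpace.single i 1) i

/-- The total variation `∫_Ω |∇u| ∈ [0, ∞]` of `u ∈ L¹(Ω)`: the supremum of `∫_Ω u div ψ` over all
`ψ ∈ C_c^1(Ω; ℝ^d)` with `|ψ| ≤ 1`. It is `∞` exactly when `u` is not in `BV(Ω)`. -/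
def totalVariation {d : ℕ} (Ω : Set (EuclideanSpace ℝ (Fin d)))
    (u : EuclideanSpace ℝ (Fin d) → ℝ) : ℝ≥0∞ :=
  ⨆ (ψ : EuclideanSpace ℝ (Fin d) → EuclideanSpace ℝ (Fin d)) (_ : ContDiff ℝ 1 ψ)
    (_ : HasCompactSupport ψ) (_ : tsupport ψ ⊆ Ω) (_ : ∀ x, ‖ψ x‖ ≤ 1),
    ENNReal.ofReal (∫ x in Ω, u x * divergence ψ x)

end

/-! Suppose `Λ_η(u) ≤ b` for all `0 < η ≤ δ`; it suffices to deduce `∫ u div ψ ≤ b` for every test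
field. Truncation is 1-Lipschitz and `φ` is non-decreasing, so truncating `u` does not raise the
energies, and a bounded `v` may be treated first.

The key is to average the bound over scales with weight `dη/η` on `[k, δ]`. The right side becomes
`b log (δ/k)`. On the left, the substitution `s = t/η` turns `∫ φ(t/η) dη` into `t ∫ φ(s) s⁻² ds`,
so for any `c < I = ∫ φ(s) s⁻² ds` the integral of `c |v(x+h) - v(x)| / |h|^{d+1}` over `x` in a
compact subset of `Ω` and `k < |h| < R` is at most `b log (δ/k) + C`, with `C` independent of `k`
(`exists_shell_bound_of_scaledEnergy_le`).

This functional of `v` is convex and compatible with translations, so a mollification `w` inherits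
the bound on a smaller compact set (`lintegral_shell_mollify_le`). For `w` of class `C¹` it grows at
least like `c γ_d (∫ |∇w|) log (1/k)`; comparing the coefficients of `log (1/k)` as `k → 0` gives `c
γ_d ∫ |∇w| ≤ b` (`lintegral_norm_gradient_le_of_shell_bound`). Integration by parts bounds `∫ w div
ψ`. It remains to remove the mollification, let `c → I`, where `γ_d I = 1`, and remove the
truncation. -/

/-! ### Polar coordinates and integrals over shells -/

/-- Integration in polar coordinates of a product of a radial and an angular function. -/
theorem lintegral_norm_mul_direction {E : Type*} [NormedAddCommGroup E] [NormedSpace ℝ E]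
    [MeasurableSpace E] [BorelSpace E] [FiniteDimensional ℝ E] [Nontrivial E]
    (μ : Measure E) [μ.IsAddHaarMeasure] {F : ℝ → ℝ≥0∞} {G : E → ℝ≥0∞}
    (hF : Measurable F) (hG : Measurable G) :
    ∫⁻ x, F ‖x‖ * G (‖x‖⁻¹ • x) ∂μ =
      (∫⁻ σ : Metric.sphere (0 : E) 1, G σ ∂μ.toSphere) *
        ∫⁻ s in Ioi (0 : ℝ), ENNReal.ofReal (s ^ (Module.finrank ℝ E - 1)) * F s := by
  have h1 : ∫⁻ x, F ‖x‖ * G (‖x‖⁻¹ • x) ∂μ =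
      ∫⁻ x : ({(0)}ᶜ : Set E), F ‖x.1‖ * G (‖x.1‖⁻¹ • x.1) ∂(μ.comap (↑)) := by
    rw [lintegral_subtype_comap (measurableSet_singleton _).compl
      fun x ↦ F ‖x‖ * G (‖x‖⁻¹ • x), restrict_compl_singleton]
  have h2 := (μ.measurePreserving_homeomorphUnitSphereProd).lintegral_comp_emb
    (Homeomorph.measurableEmbedding _) (fun p => F p.2 * G p.1)
  simp only [homeomorphUnitSphereProd_apply_snd_coe, homeomorphUnitSphereProd_apply_fst_coe] at h2
  rw [h1, h2, lintegral_prod _ (by fun_prop)]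
  have h3 : ∫⁻ s : Ioi (0 : ℝ), F s ∂(Measure.volumeIoiPow (Module.finrank ℝ E - 1)) =
      ∫⁻ s in Ioi (0 : ℝ), ENNReal.ofReal (s ^ (Module.finrank ℝ E - 1)) * F s := by
    rw [Measure.volumeIoiPow, lintegral_withDensity_eq_lintegral_mul _ (by fun_prop) (by fun_prop)]
    exact lintegral_subtype_comap measurableSet_Ioi
      fun s => ENNReal.ofReal (s ^ (Module.finrank ℝ E - 1)) * F s
  rw [← h3, ← lintegral_mul_const _ (by fun_prop)]
  refine lintegral_congr fun σ => ?_
  simp only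
  rw [lintegral_mul_const _ (by fun_prop), mul_comm]

/-- The spherical shell of radii `k` and `r` about the origin. -/
def shell (d : ℕ) (k r : ℝ) : Set (EuclideanSpace ℝ (Fin d)) := {h | k < ‖h‖ ∧ ‖h‖ < r}

theorem measurableSet_shell (d : ℕ) (k r : ℝ) : MeasurableSet (shell d k r) :=
  (measurableSet_lt measurable_const measurable_norm).inter
    (measurableSet_lt measurable_norm measurable_const)

theorem lintegral_Ioo_inv {k r : ℝ} (hk : 0 < k) (hkr : k ≤ r) :
    ∫⁻ s in Ioo k r, ENNReal.ofReal s⁻¹ = ENNReal.ofReal (Real.log (r / k)) := by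
  have hmem : (0 : ℝ) ∉ uIcc k r := by rw [uIcc_of_le hkr]; exact fun h => by linarith [h.1]
  rw [← integral_inv hmem, intervalIntegral.integral_of_le hkr, integral_Ioc_eq_integral_Ioo,
    ofReal_integral_eq_lintegral_ofReal]
  · have := (intervalIntegral.intervalIntegrable_inv (μ := volume) (f := id)
      (fun x hx h => hmem (by simpa [← h] using hx)) continuousOn_id)
    exact ((intervalIntegrable_iff_integrableOn_Ioo_of_le hkr).1 this)
  · filter_upwards [ae_restrict_mem measurableSet_Ioo] with s hs
    exact inv_nonneg.2 (hk.trans hs.1).le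

theorem lintegral_Ioi_sq_inv {k : ℝ} (hk : 0 < k) :
    ∫⁻ s in Ioi k, ENNReal.ofReal (s ^ 2)⁻¹ = ENNReal.ofReal k⁻¹ := by
  have hI := integrableOn_Ioi_rpow_of_lt (a := -2) (by norm_num) hk
  have h := integral_Ioi_rpow_of_lt (a := -2) (by norm_num) hk
  have h' : ∫⁻ s in Ioi k, ENNReal.ofReal (s ^ 2)⁻¹ =
      ∫⁻ s in Ioi k, ENNReal.ofReal (s ^ (-2 : ℝ)) := by
    refine setLIntegral_congr_fun measurableSet_Ioi fun s hs => ?_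
    rw [Real.rpow_neg (hk.trans hs).le, ← Real.rpow_natCast]; norm_num
  rw [h', ← ofReal_integral_eq_lintegral_ofReal hI, h]
  · norm_num [Real.rpow_neg_one]
  · filter_upwards [ae_restrict_mem measurableSet_Ioi] with s hs
    exact Real.rpow_nonneg (hk.trans hs).le _

theorem lintegral_shell_norm_mul_direction {d : ℕ} (hd : 1 ≤ d) {k r : ℝ} (hk : 0 < k)
    {F : ℝ → ℝ≥0∞} {G : EuclideanSpace ℝ (Fin d) → ℝ≥0∞} (hF : Measurable F) (hG : Measurable G) :
    ∫⁻ h in shell d k r, F ‖h‖ * G (‖h‖⁻¹ • h) =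
      (∫⁻ σ : Metric.sphere (0 : EuclideanSpace ℝ (Fin d)) 1, G σ ∂(volume.toSphere)) *
        ∫⁻ s in Ioo k r, ENNReal.ofReal (s ^ (d - 1)) * F s := by
  have : Nonempty (Fin d) := ⟨⟨0, hd⟩⟩
  have key := lintegral_norm_mul_direction (volume : Measure (EuclideanSpace ℝ (Fin d)))
    (hF.indicator (measurableSet_Ioo (a := k) (b := r))) hG
  rw [finrank_euclideanSpace_fin] at key
  have e1 : ∫⁻ h in shell d k r, F ‖h‖ * G (‖h‖⁻¹ • h) =
      ∫⁻ h, (Ioo k r).indicator F ‖h‖ * G (‖h‖⁻¹ • h) := by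
    rw [← lintegral_indicator (measurableSet_shell d k r)]
    refine lintegral_congr fun h => ?_
    by_cases hh : h ∈ shell d k r
    · rw [indicator_of_mem hh, indicator_of_mem (show ‖h‖ ∈ Ioo k r from hh)]
    · rw [indicator_of_notMem hh, indicator_of_notMem (show ‖h‖ ∉ Ioo k r from hh), zero_mul]
  have e2 : ∫⁻ s in Ioo k r, ENNReal.ofReal (s ^ (d - 1)) * F s =
      ∫⁻ s in Ioi 0, ENNReal.ofReal (s ^ (d - 1)) * (Ioo k r).indicator F s := by
    have : ∀ s, ENNReal.ofReal (s ^ (d - 1)) * (Ioo k r).indicator F s =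
        (Ioo k r).indicator (fun s => ENNReal.ofReal (s ^ (d - 1)) * F s) s := fun s => by
      by_cases hs : s ∈ Ioo k r <;> simp [hs]
    simp_rw [this]
    rw [lintegral_indicator measurableSet_Ioo, Measure.restrict_restrict measurableSet_Ioo,
      inter_eq_left.2 (show Ioo k r ⊆ Ioi 0 from fun s hs => hk.trans hs.1)]
  rw [e1, e2, key]

/-- The integrand is homogeneous of degree `-d`, so the radial integral is `∫ ds/s`. This is the
source of both the constant `γ_d` and the logarithm. -/
theorem lintegral_shell_abs_inner {d : ℕ} (hd : 1 ≤ d) {k r : ℝ} (hk : 0 < k) (hkr : k ≤ r)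
    (g : EuclideanSpace ℝ (Fin d)) :
    ∫⁻ h in shell d k r, ENNReal.ofReal (|inner ℝ h g| / ‖h‖ ^ (d + 1)) =
      ENNReal.ofReal (sphereConst d g) * ENNReal.ofReal (Real.log (r / k)) := by
  have key := lintegral_shell_norm_mul_direction hd (k := k) (r := r) hk
    (F := fun s => ENNReal.ofReal (s ^ d)⁻¹)
    (G := fun σ => ENNReal.ofReal |inner ℝ σ g|) (by fun_prop) (by fun_prop)
  have e1 : ∫⁻ s in Ioo k r, ENNReal.ofReal (s ^ (d - 1)) * ENNReal.ofReal (s ^ d)⁻¹ =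
      ∫⁻ s in Ioo k r, ENNReal.ofReal s⁻¹ := by
    refine setLIntegral_congr_fun measurableSet_Ioo fun s hs => ?_
    have hs0 : 0 < s := hk.trans hs.1
    rw [← ENNReal.ofReal_mul (by positivity)]
    congr 1
    obtain ⟨n, rfl⟩ : ∃ n, d = n + 1 := ⟨d - 1, by omega⟩
    simp only [Nat.add_sub_cancel]
    field_simp
    ring
  rw [e1, lintegral_Ioo_inv hk hkr] at key
  have e2 : ∫⁻ h in shell d k r, ENNReal.ofReal (|inner ℝ h g| / ‖h‖ ^ (d + 1)) =
      ∫⁻ h in shell d k r, ENNReal.ofReal (‖h‖ ^ d)⁻¹ * ENNReal.ofReal |inner ℝ (‖h‖⁻¹ • h) g| := by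
    refine setLIntegral_congr_fun (measurableSet_shell d k r) fun h hh => ?_
    have h0 : 0 < ‖h‖ := hk.trans hh.1
    rw [← ENNReal.ofReal_mul (by positivity), real_inner_smul_left, abs_mul,
      abs_of_pos (inv_pos.2 h0)]
    congr 1
    field_simp
    ring
  rw [e2, key, sphereConst, ofReal_integral_eq_lintegral_ofReal]
  · refine Integrable.of_bound (C := ‖g‖) (by fun_prop) (ae_of_all _ fun σ => ?_)
    have := abs_real_inner_le_norm (σ : EuclideanSpace ℝ (Fin d)) g
    rw [norm_eq_of_mem_sphere, one_mul] at this
    simpa using this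
  · exact ae_of_all _ fun σ => abs_nonneg _

theorem sphereConst_nonneg (d : ℕ) (g : EuclideanSpace ℝ (Fin d)) : 0 ≤ sphereConst d g :=
  integral_nonneg fun _ => abs_nonneg _

/-- The constant is read off from a shell integral for Lebesgue measure, which is invariant under
the reflection taking `e` to `g`. -/
theorem sphereConst_eq_of_norm_eq {d : ℕ} (hd : 1 ≤ d) {e g : EuclideanSpace ℝ (Fin d)}
    (h : ‖e‖ = ‖g‖) : sphereConst d e = sphereConst d g := by
  have he := lintegral_shell_abs_inner hd (k := 1) (r := 2) one_pos one_le_two e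
  have hg := lintegral_shell_abs_inner hd (k := 1) (r := 2) one_pos one_le_two g
  set R := Submodule.reflection (ℝ ∙ (e - g))ᗮ
  have hR : R e = g := Submodule.reflection_sub h
  have hpre : shell d 1 2 = R ⁻¹' shell d 1 2 := by
    ext x; simp [shell]
  have hinv := R.measurePreserving.setLIntegral_comp_preimage_emb
    R.toHomeomorph.measurableEmbedding
    (fun x => ENNReal.ofReal (|inner ℝ x g| / ‖x‖ ^ (d + 1))) (shell d 1 2)
  rw [← hpre] at hinv
  have e1 : ∀ x, inner ℝ (R x) g = inner ℝ x e := fun x => by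
    rw [← hR, R.inner_map_map]
  simp only [e1, R.norm_map] at hinv
  rw [he, hg] at hinv
  have hlog : 0 < Real.log (2 / 1) := Real.log_pos (by norm_num)
  rw [ENNReal.mul_left_inj (by simpa using hlog) ENNReal.ofReal_ne_top] at hinv
  exact (ENNReal.ofReal_eq_ofReal_iff (sphereConst_nonneg _ _) (sphereConst_nonneg _ _)).1 hinv

theorem sphereConst_eq_norm_mul {d : ℕ} (hd : 1 ≤ d) {e : EuclideanSpace ℝ (Fin d)}
    (he : ‖e‖ = 1) (g : EuclideanSpace ℝ (Fin d)) :
    sphereConst d g = ‖g‖ * sphereConst d e := by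
  rw [sphereConst_eq_of_norm_eq hd (e := g) (g := ‖g‖ • e) (by simp [norm_smul, he])]
  simp only [sphereConst, real_inner_smul_right, abs_mul, abs_norm, integral_const_mul]

theorem lintegral_shell_norm_pow_inv {d : ℕ} (hd : 1 ≤ d) {k r : ℝ} (hk : 0 < k) (hkr : k ≤ r) :
    ∫⁻ h in shell d k r, ENNReal.ofReal (‖h‖ / ‖h‖ ^ (d + 1)) =
      (volume : Measure (EuclideanSpace ℝ (Fin d))).toSphere univ *
        ENNReal.ofReal (Real.log (r / k)) := by
  have key := lintegral_shell_norm_mul_direction hd (k := k) (r := r) hk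
    (F := fun s => ENNReal.ofReal (s / s ^ (d + 1))) (G := fun _ => 1) (by fun_prop) (by fun_prop)
  simp only [mul_one, lintegral_const, one_mul] at key
  rw [key, ← lintegral_Ioo_inv hk hkr]
  congr 1
  refine setLIntegral_congr_fun measurableSet_Ioo fun s hs => ?_
  have hs0 : 0 < s := hk.trans hs.1
  rw [← ENNReal.ofReal_mul (by positivity)]
  congr 1
  obtain ⟨n, rfl⟩ : ∃ n, d = n + 1 := ⟨d - 1, by omega⟩
  simp only [Nat.add_sub_cancel]
  field_simp
  ring

/-- The bound does not depend on `k`: increments of size `O(k)` therefore cost only a constant,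
negligible against `log (1/k)`. -/
theorem lintegral_shell_inv_pow_succ_le {d : ℕ} (hd : 1 ≤ d) {k r : ℝ} (hk : 0 < k) :
    ∫⁻ h in shell d k r, ENNReal.ofReal (k / ‖h‖ ^ (d + 1)) ≤
      (volume : Measure (EuclideanSpace ℝ (Fin d))).toSphere univ := by
  have key := lintegral_shell_norm_mul_direction hd (k := k) (r := r) hk
    (F := fun s => ENNReal.ofReal (k / s ^ (d + 1))) (G := fun _ => 1) (by fun_prop) (by fun_prop)
  simp only [mul_one, lintegral_const, one_mul] at key
  rw [key]
  refine mul_le_of_le_one_right' ?_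
  calc ∫⁻ s in Ioo k r, ENNReal.ofReal (s ^ (d - 1)) * ENNReal.ofReal (k / s ^ (d + 1))
      = ∫⁻ s in Ioo k r, ENNReal.ofReal k * ENNReal.ofReal (s ^ 2)⁻¹ := by
        refine setLIntegral_congr_fun measurableSet_Ioo fun s hs => ?_
        have hs0 : 0 < s := hk.trans hs.1
        rw [← ENNReal.ofReal_mul (by positivity), ← ENNReal.ofReal_mul hk.le]
        congr 1
        obtain ⟨n, rfl⟩ : ∃ n, d = n + 1 := ⟨d - 1, by omega⟩
        simp only [Nat.add_sub_cancel]
        field_simp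
        ring
    _ ≤ ∫⁻ s in Ioi k, ENNReal.ofReal k * ENNReal.ofReal (s ^ 2)⁻¹ :=
        lintegral_mono_set fun s hs => hs.1
    _ = 1 := by
        rw [lintegral_const_mul _ (by fun_prop), lintegral_Ioi_sq_inv hk,
          ← ENNReal.ofReal_mul hk.le, mul_inv_cancel₀ hk.ne', ENNReal.ofReal_one]

/-! ### Recovering the gradient from logarithmic growth -/

theorem nonpos_of_forall_mul_neg_log_le {A B k₀ : ℝ} (hk₀ : 0 < k₀)
    (h : ∀ k, 0 < k → k < k₀ → A * (-Real.log k) ≤ B) : A ≤ 0 := by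
  by_contra! hA
  have hlim : Tendsto (fun k => A * (-Real.log k)) (𝓝[>] 0) atTop :=
    (tendsto_neg_atBot_atTop.comp Real.tendsto_log_nhdsGT_zero).const_mul_atTop hA
  obtain ⟨k, h1, h2⟩ := ((hlim.eventually_gt_atTop B).and (Ioo_mem_nhdsGT hk₀)).exists
  exact absurd (h k h2.1 h2.2) (not_le.2 h1)

/-- The derivative is uniformly continuous near the compact set `K`, also when only one of the two
points lies in `K`; the mean value inequality then makes the linearization error at most `κ ‖h‖`,
uniformly in `x ∈ K`. -/
theorem exists_abs_inner_gradient_le {E : Type*} [NormedAddCommGroup E] [InnerProductSpace ℝ E]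
    [CompleteSpace E] {w : E → ℝ} (hw : ContDiff ℝ 1 w) {K : Set E} (hK : IsCompact K) {κ : ℝ}
    (hκ : 0 < κ) :
    ∃ r, 0 < r ∧ ∀ x ∈ K, ∀ h, ‖h‖ < r →
      |inner ℝ h (gradient w x)| ≤ |w (x + h) - w x| + κ * ‖h‖ := by
  have hc : Continuous (fderiv ℝ w) := hw.continuous_fderiv one_ne_zero
  have := hK.uniformContinuousAt_of_continuousAt (fderiv ℝ w) (fun x _ => hc.continuousAt)
    (Metric.dist_mem_uniformity hκ)
  obtain ⟨r, hr, hr'⟩ := Metric.mem_uniformity_dist.1 this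
  refine ⟨r, hr, fun x hx h hh => ?_⟩
  have hb := (convex_ball x r).norm_image_sub_le_of_norm_fderiv_le' (f := w) (𝕜 := ℝ)
    (φ := fderiv ℝ w x) (C := κ) (x := x) (y := x + h)
    (fun y _ => (hw.differentiable one_ne_zero).differentiableAt)
    (fun y hy => by
      have := hr' (show dist x y < r by rw [dist_comm]; exact hy) hx
      simp only [mem_ofPred_eq, dist_eq_norm] at this
      rw [norm_sub_rev]; exact this.le)
    (Metric.mem_ball_self hr) (by simpa using hh)
  rw [add_sub_cancel_left, Real.norm_eq_abs] at hb
  have e : inner ℝ h (gradient w x) = fderiv ℝ w x h := by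
    rw [real_inner_comm, gradient, InnerProductSpace.toDual_symm_apply]
  rw [e]
  have := abs_sub_abs_le_abs_sub (fderiv ℝ w x h) (w (x + h) - w x)
  rw [abs_sub_comm _ (w (x + h) - w x)] at this
  linarith

/-- On shells of small outer radius `w` is nearly linear, so the left side of `H` is at least about
`c γ ∫ |∇w| log (1/k)`. The constant `C` and the radii `δ`, `R` do not affect the coefficient of
`log (1/k)`. -/
theorem lintegral_norm_gradient_le_of_shell_bound {d : ℕ} (hd : 1 ≤ d)
    {w : EuclideanSpace ℝ (Fin d) → ℝ} (hw : ContDiff ℝ 1 w) {K : Set (EuclideanSpace ℝ (Fin d))}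
    (hK : IsCompact K) {b c C δ R : ℝ} (hb : 0 ≤ b) (hc : 0 < c) (hC : 0 ≤ C) (hδ : 0 < δ)
    (hR : 0 < R)
    (H : ∀ k, 0 < k → k < δ → k < R →
      ENNReal.ofReal c * ∫⁻ x in K, ∫⁻ h in shell d k R,
        ENNReal.ofReal (|w (x + h) - w x| / ‖h‖ ^ (d + 1)) ≤
          ENNReal.ofReal (b * Real.log (δ / k) + C))
    {e : EuclideanSpace ℝ (Fin d)} (he : ‖e‖ = 1) :
    ENNReal.ofReal (c * sphereConst d e) * ∫⁻ x in K, ENNReal.ofReal ‖gradient w x‖ ≤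
      ENNReal.ofReal b := by
  set γ := sphereConst d e
  have hγ : 0 ≤ γ := sphereConst_nonneg d e
  have hgc : Continuous (gradient w) :=
    (InnerProductSpace.toDual ℝ _).symm.continuous.comp (hw.continuous_fderiv one_ne_zero)
  have hGfin : ∫⁻ x in K, ENNReal.ofReal ‖gradient w x‖ ≠ ⊤ := by
    have h1 := (hgc.norm.continuousOn.integrableOn_compact (μ := volume) hK)
    rw [← ofReal_integral_eq_lintegral_ofReal h1 (ae_of_all _ fun _ => norm_nonneg _)]
    exact ENNReal.ofReal_ne_top
  set G := (∫⁻ x in K, ENNReal.ofReal ‖gradient w x‖).toReal with hGdef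
  have hG : ∫⁻ x in K, ENNReal.ofReal ‖gradient w x‖ = ENNReal.ofReal G :=
    (ENNReal.ofReal_toReal hGfin).symm
  have hG0 : 0 ≤ G := ENNReal.toReal_nonneg
  set S := ((volume : Measure (EuclideanSpace ℝ (Fin d))).toSphere univ * volume K).toReal
  have hS : (volume : Measure (EuclideanSpace ℝ (Fin d))).toSphere univ * volume K =
      ENNReal.ofReal S :=
    (ENNReal.ofReal_toReal (ENNReal.mul_ne_top (measure_ne_top _ _) hK.measure_ne_top)).symm
  have hS0 : 0 ≤ S := ENNReal.toReal_nonneg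
  have main : ∀ κ, 0 < κ → c * γ * G - c * κ * S - b ≤ 0 := by
    intro κ hκ
    obtain ⟨r', hr', hrw⟩ := exists_abs_inner_gradient_le hw hK hκ
    -- Linearization needs `r ≤ r'`; `r ≤ R` keeps the shell inside that of `H`.
    set r := min r' R
    have hr : 0 < r := lt_min hr' hR
    -- Once `log (r/k)` and `log (δ/k)` are expanded, the coefficient of `-log k` is the quantity to
    -- be bounded, and `B` collects the terms free of `k`.
    refine nonpos_of_forall_mul_neg_log_le (k₀ := min r δ)
      (B := b * Real.log δ + C - (c * γ * G - c * κ * S) * Real.log r) (lt_min hr hδ) ?_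
    intro k hk hk'
    have hkr : k < r := hk'.trans_le (min_le_left _ _)
    have hkδ : k < δ := hk'.trans_le (min_le_right _ _)
    have hkR : k < R := hkr.trans_le (min_le_right _ _)
    have hl : 0 ≤ Real.log (r / k) := Real.log_nonneg ((one_le_div hk).2 hkr.le)
    have hl' : 0 ≤ Real.log (δ / k) := Real.log_nonneg ((one_le_div hk).2 hkδ.le)
    have hx : ∀ x ∈ K, ENNReal.ofReal (γ * Real.log (r / k)) * ENNReal.ofReal ‖gradient w x‖ ≤
        (∫⁻ h in shell d k R, ENNReal.ofReal (|w (x + h) - w x| / ‖h‖ ^ (d + 1))) +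
          ENNReal.ofReal κ * ((volume : Measure (EuclideanSpace ℝ (Fin d))).toSphere univ *
            ENNReal.ofReal (Real.log (r / k))) := by
      intro x hx
      calc ENNReal.ofReal (γ * Real.log (r / k)) * ENNReal.ofReal ‖gradient w x‖
          = ∫⁻ h in shell d k r, ENNReal.ofReal (|inner ℝ h (gradient w x)| / ‖h‖ ^ (d + 1)) := by
            rw [lintegral_shell_abs_inner hd hk hkr.le, sphereConst_eq_norm_mul hd he,
              ENNReal.ofReal_mul hγ, ENNReal.ofReal_mul (norm_nonneg _)]
            ring
        _ ≤ ∫⁻ h in shell d k r, (ENNReal.ofReal (|w (x + h) - w x| / ‖h‖ ^ (d + 1)) +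
              ENNReal.ofReal κ * ENNReal.ofReal (‖h‖ / ‖h‖ ^ (d + 1))) := by
            refine setLIntegral_mono' (measurableSet_shell d k r) fun h hh => ?_
            rw [← ENNReal.ofReal_mul hκ.le, ← ENNReal.ofReal_add (by positivity) (by positivity),
              ← mul_div_assoc, ← add_div]
            exact ENNReal.ofReal_le_ofReal (div_le_div_of_nonneg_right
              (hrw x hx h (hh.2.trans_le (min_le_left _ _))) (by positivity))
        _ = (∫⁻ h in shell d k r, ENNReal.ofReal (|w (x + h) - w x| / ‖h‖ ^ (d + 1))) +
              ENNReal.ofReal κ * ∫⁻ h in shell d k r, ENNReal.ofReal (‖h‖ / ‖h‖ ^ (d + 1)) := by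
            rw [lintegral_add_right _ (by fun_prop), lintegral_const_mul _ (by fun_prop)]
        _ ≤ _ := by
            rw [lintegral_shell_norm_pow_inv hd hk hkr.le]
            gcongr
            exact fun h hh => ⟨hh.1, hh.2.trans_le (min_le_right _ _)⟩
    have hint := setLIntegral_mono' (μ := volume) hK.measurableSet hx
    rw [lintegral_const_mul' _ _ ENNReal.ofReal_ne_top, hG, lintegral_add_right _ (by fun_prop),
      setLIntegral_const] at hint
    have hfin : ENNReal.ofReal c * (ENNReal.ofReal (γ * Real.log (r / k)) * ENNReal.ofReal G) ≤
        ENNReal.ofReal (b * Real.log (δ / k) + C) +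
          ENNReal.ofReal c * (ENNReal.ofReal κ * (ENNReal.ofReal S *
            ENNReal.ofReal (Real.log (r / k)))) := by
      refine (mul_le_mul_right hint _).trans ?_
      rw [mul_add, ← hS]
      refine add_le_add (H k hk hkδ hkR) (le_of_eq (by ring))
    rw [← ENNReal.ofReal_mul (by positivity), ← ENNReal.ofReal_mul (by positivity),
      ← ENNReal.ofReal_mul (by positivity), ← ENNReal.ofReal_mul (by positivity),
      ← ENNReal.ofReal_mul (by positivity), ← ENNReal.ofReal_add (by positivity) (by positivity),
      ENNReal.ofReal_le_ofReal_iff (by positivity)] at hfin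
    rw [Real.log_div hr.ne' hk.ne', Real.log_div hδ.ne' hk.ne'] at hfin
    linarith
  have hfinal : c * γ * G ≤ b := by
    refine le_of_forall_pos_le_add fun ε hε => ?_
    -- Here `κ` is sent to `0`; the summand `1` covers the case `S = 0`.
    have hpos : 0 < c * S + 1 := by positivity
    have := main (ε / (c * S + 1)) (by positivity)
    have h2 : c * (ε / (c * S + 1)) * S ≤ ε := by
      rw [mul_div_assoc', div_mul_eq_mul_div, div_le_iff₀ hpos]
      nlinarith
    linarith
  rw [hG, ← ENNReal.ofReal_mul (by positivity)]
  exact ENNReal.ofReal_le_ofReal hfinal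

/-! ### Integration by parts -/

theorem integral_mul_divergence {d : ℕ} {w : EuclideanSpace ℝ (Fin d) → ℝ} (hw : ContDiff ℝ 1 w)
    {ψ : EuclideanSpace ℝ (Fin d) → EuclideanSpace ℝ (Fin d)} (hψ : ContDiff ℝ 1 ψ)
    (hc : HasCompactSupport ψ) :
    ∫ x, w x * divergence ψ x = -∫ x, inner ℝ (gradient w x) (ψ x) := by
  have hcomp : ∀ i, ContDiff ℝ 1 fun x => ψ x i := fun i => by fun_prop
  have hcc : ∀ i, HasCompactSupport fun x => ψ x i := fun i =>
    hc.comp_left (g := fun v : EuclideanSpace ℝ (Fin d) => v i) rfl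
  have hd : ∀ i x v, fderiv ℝ ψ x v i = fderiv ℝ (fun x => ψ x i) x v := fun i x v => by
    have := ((EuclideanSpace.proj (𝕜 := ℝ) i).hasFDerivAt.comp x
      (hψ.differentiable one_ne_zero x).hasFDerivAt).fderiv
    exact (congrArg (fun L => L v) this).symm
  have hdc : ∀ i (v : EuclideanSpace ℝ (Fin d)),
      Continuous fun x => fderiv ℝ (fun x => ψ x i) x v := fun i v =>
    ((hcomp i).continuous_fderiv one_ne_zero).clm_apply continuous_const
  have hwc : ∀ v : EuclideanSpace ℝ (Fin d), Continuous fun x => fderiv ℝ w x v := fun v =>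
    (hw.continuous_fderiv one_ne_zero).clm_apply continuous_const
  have hdcs : ∀ i (v : EuclideanSpace ℝ (Fin d)),
      HasCompactSupport fun x => fderiv ℝ (fun x => ψ x i) x v := fun i v =>
    ((hcc i).fderiv (𝕜 := ℝ)).comp_left (g := fun L : EuclideanSpace ℝ (Fin d) →L[ℝ] ℝ => L v) rfl
  have hI1 : ∀ i, Integrable fun x => w x * fderiv ℝ (fun x => ψ x i) x
      (EuclideanSpace.single i 1) := fun i =>
    (hw.continuous.mul (hdc i _)).integrable_of_hasCompactSupport ((hdcs i _).mul_left)
  have hI2 : ∀ i, Integrable fun x => fderiv ℝ w x (EuclideanSpace.single i 1) * ψ x i := fun i =>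
    ((hwc _).mul (hcomp i).continuous).integrable_of_hasCompactSupport ((hcc i).mul_left)
  have hI3 : ∀ i, Integrable fun x => w x * ψ x i := fun i =>
    (hw.continuous.mul (hcomp i).continuous).integrable_of_hasCompactSupport ((hcc i).mul_left)
  have e1 : ∀ x, w x * divergence ψ x =
      ∑ i, w x * fderiv ℝ (fun x => ψ x i) x (EuclideanSpace.single i 1) := fun x => by
    simp only [divergence, Finset.mul_sum, hd]
  have e2 : ∀ x, inner ℝ (gradient w x) (ψ x) =
      ∑ i, fderiv ℝ w x (EuclideanSpace.single i 1) * ψ x i := fun x => by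
    rw [gradient, InnerProductSpace.toDual_symm_apply]
    conv_lhs => rw [← (EuclideanSpace.basisFun (Fin d) ℝ).sum_repr (ψ x)]
    simp [map_sum, mul_comm]
  simp_rw [e1, e2]
  rw [integral_finsetSum _ fun i _ => hI1 i, integral_finsetSum _ fun i _ => hI2 i,
    ← Finset.sum_neg_distrib]
  refine Finset.sum_congr rfl fun i _ => ?_
  exact integral_mul_fderiv_eq_neg_fderiv_mul_of_integrable (hI2 i) (hI1 i) (hI3 i)
    (fun x _ => hw.differentiable one_ne_zero x)
    (fun x _ => (hcomp i).differentiable one_ne_zero x)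

theorem ofReal_integral_mul_divergence_le {d : ℕ} {w : EuclideanSpace ℝ (Fin d) → ℝ}
    (hw : ContDiff ℝ 1 w) {ψ : EuclideanSpace ℝ (Fin d) → EuclideanSpace ℝ (Fin d)}
    (hψ : ContDiff ℝ 1 ψ) (hc : HasCompactSupport ψ) (hle : ∀ x, ‖ψ x‖ ≤ 1) :
    ENNReal.ofReal (∫ x, w x * divergence ψ x) ≤
      ∫⁻ x in tsupport ψ, ENNReal.ofReal ‖gradient w x‖ := by
  have hgc : Continuous (gradient w) :=
    (InnerProductSpace.toDual ℝ _).symm.continuous.comp (hw.continuous_fderiv one_ne_zero)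
  have hz : ∀ x, x ∉ tsupport ψ → -inner ℝ (gradient w x) (ψ x) = 0 := fun x hx => by
    rw [image_eq_zero_of_notMem_tsupport hx, inner_zero_right, neg_zero]
  have h1 : IntegrableOn (fun x => ‖gradient w x‖) (tsupport ψ) :=
    hgc.norm.continuousOn.integrableOn_compact hc
  rw [integral_mul_divergence hw hψ hc, ← integral_neg,
    ← setIntegral_eq_integral_of_forall_compl_eq_zero hz,
    ← ofReal_integral_eq_lintegral_ofReal h1 (ae_of_all _ fun _ => norm_nonneg _)]
  refine ENNReal.ofReal_le_ofReal (setIntegral_mono ?_ h1 fun x => ?_)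
  · exact ((hgc.inner hψ.continuous).neg.continuousOn).integrableOn_compact hc
  · refine (neg_le_abs _).trans ((abs_real_inner_le_norm _ _).trans ?_)
    exact mul_le_of_le_one_right (norm_nonneg _) (hle x)

/-! ### Averaging over the scale -/

/-- Change of variables `δ = t/s`, with `|dδ| = t s⁻² ds`: this is how the weight `s⁻²` of the
normalization arises. -/
theorem lintegral_Icc_comp_div {f : ℝ → ℝ≥0∞} {t τ T : ℝ} (ht : 0 < t) (hτ : 0 < τ) :
    ENNReal.ofReal t * ∫⁻ s in Icc τ T, ENNReal.ofReal (s ^ 2)⁻¹ * f s =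
      ∫⁻ δ in (fun s => t / s) '' Icc τ T, f (t / δ) := by
  have hpos : ∀ s ∈ Icc τ T, 0 < s := fun s hs => hτ.trans_le hs.1
  rw [lintegral_image_eq_lintegral_abs_deriv_mul measurableSet_Icc
    (f' := fun s => -t / s ^ 2) (fun s hs => ?_) (fun s hs s' hs' h => ?_),
    ← lintegral_const_mul' _ _ ENNReal.ofReal_ne_top]
  · refine setLIntegral_congr_fun measurableSet_Icc fun s hs => ?_
    have hs0 := hpos s hs
    rw [← mul_assoc, ← ENNReal.ofReal_mul ht.le, neg_div, abs_neg, abs_of_pos (by positivity),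
      div_div_cancel₀ ht.ne', div_eq_mul_inv]
  · have hs0 := hpos s hs
    have := ((hasDerivAt_inv hs0.ne').const_mul t).hasDerivWithinAt (s := Icc τ T)
    simpa [div_eq_mul_inv] using this
  · have h1 := hpos s hs
    have h2 := hpos s' hs'
    rw [div_eq_div_iff h1.ne' h2.ne'] at h
    exact (mul_left_cancel₀ ht.ne' h).symm

/-- Averaging `φ(t/δ)` over `δ` recovers `t ∫ φ(s) s⁻² ds` up to controlled errors. -/
theorem ofReal_mul_le_lintegral_profile {φ : ℝ → ℝ} (hmono : Monotone φ)
    {c τ T k δ δ' N p t : ℝ} (hc : 0 < c) (hτ : 0 < τ) (hT : 0 < T) (hk : 0 < k) (hδ' : 0 < δ')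
    (hcφ : ENNReal.ofReal c ≤ ∫⁻ s in Icc τ T, ENNReal.ofReal (φ s / s ^ 2))
    (hp : 0 < p) (hpφ : p ≤ φ (τ * δ / δ')) (ht : 0 ≤ t) (htN : t ≤ N) :
    ENNReal.ofReal (c * t) ≤ (∫⁻ η in Icc k δ, ENNReal.ofReal (φ (t / η))) +
      ENNReal.ofReal (c * N / p) * ENNReal.ofReal (φ (t / δ')) + ENNReal.ofReal (c * T * k) := by
  have hN : 0 ≤ N := ht.trans htN
  -- Increments this small are absorbed by the last error term.
  rcases le_or_gt t (T * k) with h1 | h1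
  · refine le_add_left (ENNReal.ofReal_le_ofReal ?_)
    rw [mul_assoc]; gcongr
  have ht0 : 0 < t := (by positivity : 0 < T * k).trans h1
  -- For `T k < t ≤ τ δ`, the map `s ↦ t/s` sends `[τ, T]` into `[k, δ]`, so the main term suffices.
  rcases le_or_gt t (τ * δ) with h2 | h2
  · refine le_add_right (le_add_right ?_)
    rw [mul_comm, ENNReal.ofReal_mul ht]
    calc ENNReal.ofReal t * ENNReal.ofReal c
        ≤ ENNReal.ofReal t * ∫⁻ s in Icc τ T, ENNReal.ofReal (s ^ 2)⁻¹ * ENNReal.ofReal (φ s) := by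
          gcongr
          refine hcφ.trans (lintegral_mono fun s => ?_)
          rw [← ENNReal.ofReal_mul (by positivity), div_eq_mul_inv, mul_comm]
      _ = ∫⁻ η in (fun s => t / s) '' Icc τ T, ENNReal.ofReal (φ (t / η)) :=
          lintegral_Icc_comp_div ht0 hτ
      _ ≤ _ := by
          refine lintegral_mono_set ?_
          rintro _ ⟨s, hs, rfl⟩
          have hs0 : 0 < s := hτ.trans_le hs.1
          have hδ : 0 < δ := pos_of_mul_pos_right (ht0.trans_le h2) hτ.le
          refine ⟨(le_div_iff₀ hs0).2 ?_, (div_le_iff₀ hs0).2 ?_⟩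
          · nlinarith [hs.2]
          · nlinarith [hs.1]
  -- For `t > τ δ` the profile at scale `δ'` is at least `p`, while `t ≤ N`; the middle term
  -- suffices.
  · refine le_add_right (le_add_left ?_)
    have hφt : p ≤ φ (t / δ') := hpφ.trans (hmono (by gcongr))
    rw [← ENNReal.ofReal_mul (by positivity)]
    refine ENNReal.ofReal_le_ofReal ?_
    rw [div_mul_eq_mul_div, le_div_iff₀ hp]
    gcongr

/-- Passing from increments over a shell to the double integral over `Ω`. -/
theorem lintegral_shell_increment_le {d : ℕ} {Ω K : Set (EuclideanSpace ℝ (Fin d))} {k R : ℝ}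
    (hΩ : MeasurableSet Ω) (hK : MeasurableSet K)
    (hKΩ : ∀ x ∈ K, ∀ h : EuclideanSpace ℝ (Fin d), ‖h‖ < R → x + h ∈ Ω) (hR : 0 < R)
    (F : EuclideanSpace ℝ (Fin d) → EuclideanSpace ℝ (Fin d) → ℝ≥0∞) :
    ∫⁻ x in K, ∫⁻ h in shell d k R, F x (x + h) ≤ ∫⁻ x in Ω, ∫⁻ y in Ω, F x y := by
  refine (setLIntegral_mono' hK fun x hx => ?_).trans
    (lintegral_mono_set fun x hx => by simpa using hKΩ x hx 0 (by simpa using hR))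
  calc ∫⁻ h in shell d k R, F x (x + h)
      = ∫⁻ h, (shell d k R).indicator (fun h => F x (x + h)) h :=
        (lintegral_indicator (measurableSet_shell d k R) _).symm
    _ ≤ ∫⁻ h, Ω.indicator (F x) (x + h) := by
        refine lintegral_mono fun h => ?_
        by_cases hh : h ∈ shell d k R
        · rw [indicator_of_mem hh, indicator_of_mem (hKΩ x hx h hh.2)]
        · rw [indicator_of_notMem hh]
          exact zero_le
    _ = ∫⁻ y in Ω, F x y := by
        rw [lintegral_add_left_eq_self, lintegral_indicator hΩ]

theorem lintegral_lintegral_lintegral_rotate {α β γ : Type*} [MeasurableSpace α]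
    [MeasurableSpace β] [MeasurableSpace γ] {μ : Measure α} {ν : Measure β} {ρ : Measure γ}
    [SFinite μ] [SFinite ν] [SFinite ρ] {f : α → β → γ → ℝ≥0∞}
    (hf : Measurable fun p : (α × β) × γ => f p.1.1 p.1.2 p.2) :
    ∫⁻ x, ∫⁻ y, ∫⁻ z, f x y z ∂ρ ∂ν ∂μ = ∫⁻ z, ∫⁻ x, ∫⁻ y, f x y z ∂ν ∂μ ∂ρ := by
  have hswap : ∀ x, ∫⁻ y, ∫⁻ z, f x y z ∂ρ ∂ν = ∫⁻ z, ∫⁻ y, f x y z ∂ν ∂ρ := fun x => by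
    refine lintegral_lintegral_swap ?_
    exact (hf.comp (by fun_prop : Measurable fun p : β × γ => ((x, p.1), p.2))).aemeasurable
  have h : Measurable fun q : (α × γ) × β => f q.1.1 q.2 q.1.2 :=
    hf.comp (by fun_prop : Measurable fun q : (α × γ) × β => ((q.1.1, q.2), q.1.2))
  simp_rw [hswap]
  exact lintegral_lintegral_swap h.lintegral_prod_right'.aemeasurable

theorem nonlocalEnergy_div_eq {d : ℕ} (φ : ℝ → ℝ) (Ω : Set (EuclideanSpace ℝ (Fin d)))
    (v : EuclideanSpace ℝ (Fin d) → ℝ) {δ : ℝ} (hδ : 0 < δ) :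
    nonlocalEnergy φ Ω (fun x => v x / δ) = ∫⁻ x in Ω, ∫⁻ y in Ω,
      ENNReal.ofReal (‖y - x‖ ^ (d + 1))⁻¹ * ENNReal.ofReal (φ (|v y - v x| / δ)) := by
  refine lintegral_congr fun x => lintegral_congr fun y => ?_
  rw [← sub_div, abs_div, abs_of_pos hδ, ← ENNReal.ofReal_mul (by positivity), norm_sub_rev,
    abs_sub_comm, div_eq_mul_inv, mul_comm]

/-- Boundedness of the energies for small `δ` controls the increments of a bounded function over
shells, up to a constant that does not depend on the inner radius. -/
theorem exists_shell_bound_of_scaledEnergy_le {d : ℕ} (hd : 1 ≤ d) {φ : ℝ → ℝ}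
    (hmono : Monotone φ) {Ω K : Set (EuclideanSpace ℝ (Fin d))}
    (hΩ : MeasurableSet Ω) (hK : IsCompact K) {R : ℝ} (hR : 0 < R)
    (hKΩ : ∀ x ∈ K, ∀ h : EuclideanSpace ℝ (Fin d), ‖h‖ < R → x + h ∈ Ω)
    {v : EuclideanSpace ℝ (Fin d) → ℝ} (hv : Measurable v) {M : ℝ} (hvM : ∀ x, |v x| ≤ M)
    {b δ : ℝ} (hb : 0 ≤ b) (hδ : 0 < δ)
    (hE : ∀ η, 0 < η → η ≤ δ → scaledEnergy φ Ω η v ≤ ENNReal.ofReal b)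
    {c τ T : ℝ} (hc : 0 < c) (hτ : 0 < τ) (hT : 0 < T)
    (hcφ : ENNReal.ofReal c ≤ ∫⁻ s in Icc τ T, ENNReal.ofReal (φ s / s ^ 2))
    {s₀ : ℝ} (hs₀ : 0 < s₀) (hφs₀ : 0 < φ s₀) :
    ∃ C, 0 ≤ C ∧ ∀ k, 0 < k → k < δ →
      ENNReal.ofReal c * ∫⁻ x in K, ∫⁻ h in shell d k R,
        ENNReal.ofReal (|v (x + h) - v x| / ‖h‖ ^ (d + 1)) ≤
          ENNReal.ofReal (b * Real.log (δ / k) + C) := by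
  have hφm : Measurable φ := hmono.measurable
  have hM : 0 ≤ M := (abs_nonneg _).trans (hvM 0)
  -- `δ' ≤ δ` makes the energy bound available at scale `δ'`, and `δ' ≤ τ δ / s₀` ensures `φ (τ δ /
  -- δ') ≥ φ s₀ > 0`.
  set δ' := min δ (τ * δ / s₀)
  have hδ' : 0 < δ' := lt_min hδ (by positivity)
  have hpφ : φ s₀ ≤ φ (τ * δ / δ') := by
    refine hmono ((le_div_iff₀ hδ').2 ?_)
    calc s₀ * δ' ≤ s₀ * (τ * δ / s₀) := by gcongr; exact min_le_right _ _
      _ = τ * δ := by field_simp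
  have hEn : ∀ η, 0 < η → η ≤ δ →
      nonlocalEnergy φ Ω (fun x => v x / η) ≤ ENNReal.ofReal (b / η) := by
    intro η h0 h1
    rw [ENNReal.ofReal_div_of_pos h0, ENNReal.le_div_iff_mul_le (by simp [h0]) (by simp), mul_comm]
    exact hE η h0 h1
  have hshell : ∀ k η, 0 < η → η ≤ δ → ∫⁻ x in K, ∫⁻ h in shell d k R,
      ENNReal.ofReal (‖h‖ ^ (d + 1))⁻¹ * ENNReal.ofReal (φ (|v (x + h) - v x| / η)) ≤
        ENNReal.ofReal (b / η) := by
    intro k η h0 h1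
    refine le_trans ?_ (hEn η h0 h1)
    rw [nonlocalEnergy_div_eq φ Ω v h0]
    refine le_trans (le_of_eq ?_) (lintegral_shell_increment_le (k := k) hΩ hK.measurableSet hKΩ hR
      fun x y => ENNReal.ofReal (‖y - x‖ ^ (d + 1))⁻¹ * ENNReal.ofReal (φ (|v y - v x| / η)))
    simp only [add_sub_cancel_left]
  set S := ((volume : Measure (EuclideanSpace ℝ (Fin d))).toSphere univ * volume K).toReal
  have hS : (volume : Measure (EuclideanSpace ℝ (Fin d))).toSphere univ * volume K =
      ENNReal.ofReal S :=
    (ENNReal.ofReal_toReal (ENNReal.mul_ne_top (measure_ne_top _ _) hK.measure_ne_top)).symm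
  have hS0 : 0 ≤ S := ENNReal.toReal_nonneg
  set q := c * (2 * M) / φ s₀
  have hq : 0 ≤ q := by positivity
  -- The first summand pays for the large increments, through the energy at scale `δ'`; the second
  -- pays for the increments below `T k`.
  refine ⟨q * (b / δ') + c * T * S, by positivity, fun k hk hkδ => ?_⟩
  have hl : 0 ≤ Real.log (δ / k) := Real.log_nonneg ((one_le_div hk).2 hkδ.le)
  have hpt : ∀ x h, ENNReal.ofReal c * ENNReal.ofReal (|v (x + h) - v x| / ‖h‖ ^ (d + 1)) ≤
      (∫⁻ η in Icc k δ, ENNReal.ofReal (‖h‖ ^ (d + 1))⁻¹ *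
        ENNReal.ofReal (φ (|v (x + h) - v x| / η))) +
      ENNReal.ofReal q * (ENNReal.ofReal (‖h‖ ^ (d + 1))⁻¹ *
        ENNReal.ofReal (φ (|v (x + h) - v x| / δ'))) +
      ENNReal.ofReal (c * T) * ENNReal.ofReal (k / ‖h‖ ^ (d + 1)) := by
    intro x h
    have htN : |v (x + h) - v x| ≤ 2 * M := (abs_sub _ _).trans (by linarith [hvM (x + h), hvM x])
    have := mul_le_mul_right (ofReal_mul_le_lintegral_profile hmono hc hτ hT hk hδ' hcφ hφs₀ hpφ
      (abs_nonneg _) htN (δ := δ)) (ENNReal.ofReal (‖h‖ ^ (d + 1))⁻¹)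
    rw [lintegral_const_mul' _ _ ENNReal.ofReal_ne_top]
    calc ENNReal.ofReal c * ENNReal.ofReal (|v (x + h) - v x| / ‖h‖ ^ (d + 1))
        = ENNReal.ofReal (‖h‖ ^ (d + 1))⁻¹ * ENNReal.ofReal (c * |v (x + h) - v x|) := by
          rw [← ENNReal.ofReal_mul hc.le, ← ENNReal.ofReal_mul (by positivity)]
          congr 1; ring
      _ ≤ _ := this
      _ = _ := by
          rw [div_eq_mul_inv k, mul_comm k, ENNReal.ofReal_mul (p := c * T) (by positivity),
            ENNReal.ofReal_mul (p := (‖h‖ ^ (d + 1))⁻¹) (by positivity)]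
          ring
  have hm : ∀ η, Measurable fun p : EuclideanSpace ℝ (Fin d) × EuclideanSpace ℝ (Fin d) =>
      ENNReal.ofReal (‖p.2‖ ^ (d + 1))⁻¹ * ENNReal.ofReal (φ (|v (p.1 + p.2) - v p.1| / η)) :=
    fun η => by fun_prop
  have hmη : Measurable fun p : (EuclideanSpace ℝ (Fin d) × EuclideanSpace ℝ (Fin d)) × ℝ =>
      ENNReal.ofReal (‖p.1.2‖ ^ (d + 1))⁻¹ *
        ENNReal.ofReal (φ (|v (p.1.1 + p.1.2) - v p.1.1| / p.2)) := by fun_prop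
  have hm3 : Measurable fun h : EuclideanSpace ℝ (Fin d) =>
      ENNReal.ofReal (c * T) * ENNReal.ofReal (k / ‖h‖ ^ (d + 1)) := by fun_prop
  have hfirst : ∫⁻ x in K, ∫⁻ h in shell d k R, ∫⁻ η in Icc k δ,
      ENNReal.ofReal (‖h‖ ^ (d + 1))⁻¹ * ENNReal.ofReal (φ (|v (x + h) - v x| / η)) ≤
        ENNReal.ofReal (b * Real.log (δ / k)) := by
    have e1 : ∫⁻ x in K, ∫⁻ h in shell d k R, ∫⁻ η in Icc k δ,
        ENNReal.ofReal (‖h‖ ^ (d + 1))⁻¹ * ENNReal.ofReal (φ (|v (x + h) - v x| / η)) =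
        ∫⁻ η in Icc k δ, ∫⁻ x in K, ∫⁻ h in shell d k R,
          ENNReal.ofReal (‖h‖ ^ (d + 1))⁻¹ * ENNReal.ofReal (φ (|v (x + h) - v x| / η)) := by
      exact lintegral_lintegral_lintegral_rotate hmη
    -- The bound `b/η` for the energy before multiplication by `η` supplies the weight `dη/η`, whose
    -- integral is `log (δ/k)`.
    rw [e1, mul_comm, ENNReal.ofReal_mul hl, ← lintegral_Ioo_inv hk hkδ.le,
      ← lintegral_mul_const _ (by fun_prop), Measure.restrict_congr_set Ioo_ae_eq_Icc]
    refine setLIntegral_mono' measurableSet_Icc fun η hη => ?_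
    have h0 : 0 < η := hk.trans_le hη.1
    refine (hshell k η h0 hη.2).trans (le_of_eq ?_)
    rw [← ENNReal.ofReal_mul (by positivity)]
    congr 1; ring
  have hthird : ∫⁻ x in K, ∫⁻ h in shell d k R,
      ENNReal.ofReal (c * T) * ENNReal.ofReal (k / ‖h‖ ^ (d + 1)) ≤
        ENNReal.ofReal (c * T * S) := by
    rw [setLIntegral_const, lintegral_const_mul _ (by fun_prop),
      ENNReal.ofReal_mul (q := S) (by positivity), ← hS, mul_assoc]
    gcongr
    exact lintegral_shell_inv_pow_succ_le hd hk
  calc ENNReal.ofReal c * ∫⁻ x in K, ∫⁻ h in shell d k R,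
        ENNReal.ofReal (|v (x + h) - v x| / ‖h‖ ^ (d + 1))
      = ∫⁻ x in K, ∫⁻ h in shell d k R,
        ENNReal.ofReal c * ENNReal.ofReal (|v (x + h) - v x| / ‖h‖ ^ (d + 1)) := by
        simp_rw [lintegral_const_mul' _ _ ENNReal.ofReal_ne_top]
    _ ≤ _ := lintegral_mono fun x => lintegral_mono fun h => hpt x h
    _ = (∫⁻ x in K, ∫⁻ h in shell d k R, ∫⁻ η in Icc k δ,
          ENNReal.ofReal (‖h‖ ^ (d + 1))⁻¹ * ENNReal.ofReal (φ (|v (x + h) - v x| / η))) +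
        ENNReal.ofReal q * (∫⁻ x in K, ∫⁻ h in shell d k R, ENNReal.ofReal (‖h‖ ^ (d + 1))⁻¹ *
          ENNReal.ofReal (φ (|v (x + h) - v x| / δ'))) +
        ∫⁻ x in K, ∫⁻ h in shell d k R,
          ENNReal.ofReal (c * T) * ENNReal.ofReal (k / ‖h‖ ^ (d + 1)) := by
        have hm2 : ∀ x : EuclideanSpace ℝ (Fin d), Measurable fun h : EuclideanSpace ℝ (Fin d) =>
          ENNReal.ofReal q *
          (ENNReal.ofReal (‖h‖ ^ (d + 1))⁻¹ *
          ENNReal.ofReal (φ (|v (x + h) - v x| / δ'))) := fun x => by fun_prop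
        simp_rw [lintegral_add_right _ hm3, lintegral_add_right _ (hm2 _),
          lintegral_const_mul' _ _ ENNReal.ofReal_ne_top]
        rw [lintegral_add_right _ (by fun_prop), lintegral_add_right,
          lintegral_const_mul' _ _ ENNReal.ofReal_ne_top]
        · rw [lintegral_const_mul' _ _ ENNReal.ofReal_ne_top]
        · exact ((hm δ').lintegral_prod_right').const_mul _
    _ ≤ ENNReal.ofReal (b * Real.log (δ / k)) + ENNReal.ofReal q * ENNReal.ofReal (b / δ') +
          ENNReal.ofReal (c * T * S) := by
        gcongr
        exact hshell k δ' hδ' (min_le_left _ _)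
    _ = _ := by
        rw [← ENNReal.ofReal_mul hq, ← ENNReal.ofReal_add (by positivity) (by positivity),
          ← ENNReal.ofReal_add (by positivity) (by positivity), add_assoc]

/-! ### Mollification -/

/-- The mollification of `v` by a normalized bump function. -/
noncomputable def mollify {d : ℕ} (ρ : ContDiffBump (0 : EuclideanSpace ℝ (Fin d)))
    (v : EuclideanSpace ℝ (Fin d) → ℝ) : EuclideanSpace ℝ (Fin d) → ℝ :=
  convolution (ρ.normed volume) v (ContinuousLinearMap.lsmul ℝ ℝ) volume

section Mollify

variable {d : ℕ} (ρ : ContDiffBump (0 : EuclideanSpace ℝ (Fin d)))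
  {v : EuclideanSpace ℝ (Fin d) → ℝ} {M : ℝ}

theorem mollify_apply (v : EuclideanSpace ℝ (Fin d) → ℝ) (x : EuclideanSpace ℝ (Fin d)) :
    mollify ρ v x = ∫ t, ρ.normed volume t * v (x - t) := rfl

theorem integrable_normed_mul (hv : Measurable v) (hvM : ∀ x, |v x| ≤ M)
    (x : EuclideanSpace ℝ (Fin d)) : Integrable fun t => ρ.normed volume t * v (x - t) := by
  have := (ρ.integrable_normed (μ := volume)).bdd_mul (f := fun t => v (x - t)) (c := M)
    (by fun_prop : Measurable fun t => v (x - t)).aestronglyMeasurable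
    (ae_of_all _ fun t => hvM (x - t))
  simpa [mul_comm] using this

theorem abs_mollify_le (hvM : ∀ x, |v x| ≤ M)
    (x : EuclideanSpace ℝ (Fin d)) : |mollify ρ v x| ≤ M := by
  rw [mollify_apply, ← Real.norm_eq_abs]
  have h : Integrable fun t => ρ.normed volume t * M := (ρ.integrable_normed).mul_const M
  refine (norm_integral_le_of_norm_le h (ae_of_all _ fun t => ?_)).trans (le_of_eq ?_)
  · rw [norm_mul, Real.norm_of_nonneg (ρ.nonneg_normed t)]
    exact mul_le_mul_of_nonneg_left (hvM _) (ρ.nonneg_normed t)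
  · rw [integral_mul_const, ρ.integral_normed, one_mul]

theorem contDiff_mollify (hv : LocallyIntegrable v) : ContDiff ℝ 1 (mollify ρ v) :=
  ρ.hasCompactSupport_normed.contDiff_convolution_left _ (ρ.contDiff_normed (n := 1)) hv

theorem lintegral_normed : ∫⁻ t, ENNReal.ofReal (ρ.normed volume t) = 1 := by
  rw [← ofReal_integral_eq_lintegral_ofReal ρ.integrable_normed (ae_of_all _ ρ.nonneg_normed),
    ρ.integral_normed, ENNReal.ofReal_one]

theorem ofReal_abs_mollify_sub_le (hv : Measurable v) (hvM : ∀ x, |v x| ≤ M)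
    (x h : EuclideanSpace ℝ (Fin d)) :
    ENNReal.ofReal |mollify ρ v (x + h) - mollify ρ v x| ≤
      ∫⁻ t, ENNReal.ofReal (ρ.normed volume t) * ENNReal.ofReal |v (x - t + h) - v (x - t)| := by
  rw [mollify_apply, mollify_apply, ← integral_sub (integrable_normed_mul ρ hv hvM _)
    (integrable_normed_mul ρ hv hvM _), ← Real.norm_eq_abs, ofReal_norm]
  refine (enorm_integral_le_lintegral_enorm _).trans (le_of_eq (lintegral_congr fun t => ?_))
  rw [← mul_sub, enorm_mul, Real.enorm_of_nonneg (ρ.nonneg_normed t), Real.enorm_eq_ofReal_abs,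
    add_sub_right_comm]

/-- Mollification does not increase the mean increments over a shell, at the price of enlarging
the domain. -/
theorem lintegral_shell_mollify_le (hv : Measurable v) (hvM : ∀ x, |v x| ≤ M)
    {K K' : Set (EuclideanSpace ℝ (Fin d))} (hK : MeasurableSet K) (hK' : MeasurableSet K')
    (hKK' : ∀ x ∈ K, ∀ t, ‖t‖ < ρ.rOut → x - t ∈ K') (k R : ℝ) :
    ∫⁻ x in K, ∫⁻ h in shell d k R,
        ENNReal.ofReal (|mollify ρ v (x + h) - mollify ρ v x| / ‖h‖ ^ (d + 1)) ≤
      ∫⁻ x in K', ∫⁻ h in shell d k R, ENNReal.ofReal (|v (x + h) - v x| / ‖h‖ ^ (d + 1)) := by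
  set Θ : EuclideanSpace ℝ (Fin d) → ℝ≥0∞ := fun x =>
    ∫⁻ h in shell d k R, ENNReal.ofReal (|v (x + h) - v x| / ‖h‖ ^ (d + 1)) with hΘ
  have hρm : Measurable (ρ.normed volume) := ρ.continuous_normed.measurable
  calc ∫⁻ x in K, ∫⁻ h in shell d k R,
        ENNReal.ofReal (|mollify ρ v (x + h) - mollify ρ v x| / ‖h‖ ^ (d + 1))
      ≤ ∫⁻ x in K, ∫⁻ h in shell d k R, ∫⁻ t, ENNReal.ofReal (ρ.normed volume t) *
          ENNReal.ofReal (|v (x - t + h) - v (x - t)| / ‖h‖ ^ (d + 1)) := by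
        refine lintegral_mono fun x => lintegral_mono fun h => ?_
        have := mul_le_mul_left (ofReal_abs_mollify_sub_le ρ hv hvM x h)
          (ENNReal.ofReal (‖h‖ ^ (d + 1))⁻¹)
        rw [← ENNReal.ofReal_mul (abs_nonneg _), ← div_eq_mul_inv,
          ← lintegral_mul_const' _ _ ENNReal.ofReal_ne_top] at this
        refine this.trans (le_of_eq (lintegral_congr fun t => ?_))
        rw [mul_assoc, ← ENNReal.ofReal_mul (abs_nonneg _), ← div_eq_mul_inv]
    _ = ∫⁻ t, ∫⁻ x in K, ∫⁻ h in shell d k R, ENNReal.ofReal (ρ.normed volume t) *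
          ENNReal.ofReal (|v (x - t + h) - v (x - t)| / ‖h‖ ^ (d + 1)) :=
        lintegral_lintegral_lintegral_rotate (by fun_prop)
    _ = ∫⁻ t, ENNReal.ofReal (ρ.normed volume t) * ∫⁻ x in K, Θ (x - t) := by
        simp_rw [lintegral_const_mul' _ _ ENNReal.ofReal_ne_top, hΘ]
    _ ≤ ∫⁻ t, ENNReal.ofReal (ρ.normed volume t) * ∫⁻ x in K', Θ x := by
        refine lintegral_mono fun t => ?_
        by_cases ht : ‖t‖ < ρ.rOut
        -- Translating by `t` carries `K` into `K'`, so the integral of `Θ (x - t)` over `K` is at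
        -- most that of `Θ` over `K'`.
        · refine mul_le_mul_right ?_ _
          rw [← lintegral_indicator hK, ← lintegral_indicator hK',
            ← lintegral_sub_right_eq_self (K'.indicator Θ) t]
          refine lintegral_mono fun x => ?_
          by_cases hx : x ∈ K
          · rw [indicator_of_mem hx, indicator_of_mem (hKK' x hx t ht)]
          · rw [indicator_of_notMem hx]
            exact zero_le
        · have : ρ.normed volume t = 0 := by
            refine Function.notMem_support.1 fun h => ht ?_
            rw [ρ.support_normed_eq] at h
            simpa using h
          simp [this]
    _ = ∫⁻ x in K', Θ x := by
        rw [lintegral_mul_const'' _ (by fun_prop), lintegral_normed, one_mul]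

end Mollify

/-! ### The lower bound for bounded functions -/

theorem continuous_divergence {d : ℕ} {ψ : EuclideanSpace ℝ (Fin d) → EuclideanSpace ℝ (Fin d)}
    (hψ : ContDiff ℝ 1 ψ) : Continuous (divergence ψ) := by
  refine continuous_finsetSum _ fun i _ => ?_
  exact (EuclideanSpace.proj (𝕜 := ℝ) i).continuous.comp
    ((hψ.continuous_fderiv one_ne_zero).clm_apply continuous_const)

theorem hasCompactSupport_divergence {d : ℕ}
    {ψ : EuclideanSpace ℝ (Fin d) → EuclideanSpace ℝ (Fin d)} (hc : HasCompactSupport ψ) :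
    HasCompactSupport (divergence ψ) :=
  (hc.fderiv (𝕜 := ℝ)).comp_left (g := fun L : EuclideanSpace ℝ (Fin d) →L[ℝ]
    EuclideanSpace ℝ (Fin d) => ∑ i, L (EuclideanSpace.single i 1) i) (by simp)

/-- Dominated convergence with majorant `M |f|`. The bounded ratio of the radii gives convergence at
almost every point by Lebesgue differentiation. -/
theorem tendsto_integral_mollify_mul {d : ℕ} {v f : EuclideanSpace ℝ (Fin d) → ℝ}
    {M : ℝ} (hvM : ∀ x, |v x| ≤ M) (hvI : Integrable v) (hf : Integrable f)
    {ρ : ℕ → ContDiffBump (0 : EuclideanSpace ℝ (Fin d))}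
    (hρ : Tendsto (fun n => (ρ n).rOut) atTop (𝓝 0)) (hρ' : ∀ n, (ρ n).rOut ≤ 2 * (ρ n).rIn) :
    Tendsto (fun n => ∫ x, mollify (ρ n) v x * f x) atTop (𝓝 (∫ x, v x * f x)) := by
  refine tendsto_integral_of_dominated_convergence (fun x => M * ‖f x‖) (fun n => ?_)
    (hf.norm.const_mul M) (fun n => ae_of_all _ fun x => ?_) ?_
  · exact (contDiff_mollify (ρ n) hvI.locallyIntegrable).continuous.aestronglyMeasurable.mul
      hf.aestronglyMeasurable
  · rw [norm_mul]
    exact mul_le_mul_of_nonneg_right (abs_mollify_le _ hvM x) (norm_nonneg _)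
  · filter_upwards [ContDiffBump.ae_convolution_tendsto_right_of_locallyIntegrable hρ
      (Eventually.of_forall hρ') hvI.locallyIntegrable] with x hx
    exact hx.mul_const _

/-- The lower bound for bounded functions, with a truncated normalization integral. -/
theorem ofReal_integral_mul_divergence_le_of_scaledEnergy_le {d : ℕ} (hd : 1 ≤ d) {φ : ℝ → ℝ}
    (hmono : Monotone φ) {Ω : Set (EuclideanSpace ℝ (Fin d))} (hΩ : IsOpen Ω)
    {v : EuclideanSpace ℝ (Fin d) → ℝ} (hv : Measurable v) {M : ℝ} (hvM : ∀ x, |v x| ≤ M)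
    (hvI : Integrable v) {b δ : ℝ} (hb : 0 ≤ b) (hδ : 0 < δ)
    (hE : ∀ η, 0 < η → η ≤ δ → scaledEnergy φ Ω η v ≤ ENNReal.ofReal b)
    {c τ T : ℝ} (hc : 0 < c) (hτ : 0 < τ) (hT : 0 < T)
    (hcφ : ENNReal.ofReal c ≤ ∫⁻ s in Icc τ T, ENNReal.ofReal (φ s / s ^ 2))
    {s₀ : ℝ} (hs₀ : 0 < s₀) (hφs₀ : 0 < φ s₀)
    {e : EuclideanSpace ℝ (Fin d)} (he : ‖e‖ = 1)
    {ψ : EuclideanSpace ℝ (Fin d) → EuclideanSpace ℝ (Fin d)} (hψ : ContDiff ℝ 1 ψ)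
    (hψc : HasCompactSupport ψ) (hψΩ : tsupport ψ ⊆ Ω) (hψ1 : ∀ x, ‖ψ x‖ ≤ 1) :
    ENNReal.ofReal (c * sphereConst d e) * ENNReal.ofReal (∫ x, v x * divergence ψ x) ≤
      ENNReal.ofReal b := by
  obtain ⟨r, hr, hrΩ⟩ := hψc.isCompact.exists_cthickening_subset_open hΩ hψΩ
  set K := tsupport ψ
  have hK : IsCompact K := hψc
  -- Half of the margin `r` is spent on mollification, the other half on the increments `h`.
  set R := r / 2 with hRdef
  have hR : 0 < R := half_pos hr
  have hK' : IsCompact (Metric.cthickening R K) := hK.cthickening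
  have hKΩ : ∀ x ∈ Metric.cthickening R K, ∀ h : EuclideanSpace ℝ (Fin d), ‖h‖ < R →
      x + h ∈ Ω := fun x hx h hh => by
    refine hrΩ ?_
    have h1 : x + h ∈ Metric.cthickening R (Metric.cthickening R K) :=
      Metric.mem_cthickening_of_dist_le _ x _ _ hx (by simpa using hh.le)
    have h2 := Metric.cthickening_cthickening_subset hR.le hR.le K h1
    rwa [hRdef, add_halves] at h2
  obtain ⟨C, hC, H⟩ := exists_shell_bound_of_scaledEnergy_le hd hmono hΩ.measurableSet hK' hR hKΩ
    hv hvM hb hδ hE hc hτ hT hcφ hs₀ hφs₀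
  set ρ : ℕ → ContDiffBump (0 : EuclideanSpace ℝ (Fin d)) := fun n =>
    { rIn := R / (n + 1) / 2
      rOut := R / (n + 1)
      rIn_pos := by positivity
      rIn_lt_rOut := half_lt_self (by positivity) }
  have hbound : ∀ n, ENNReal.ofReal (c * sphereConst d e) *
      ENNReal.ofReal (∫ x, mollify (ρ n) v x * divergence ψ x) ≤ ENNReal.ofReal b := by
    intro n
    have hw := contDiff_mollify (ρ n) hvI.locallyIntegrable
    refine (mul_le_mul_right (ofReal_integral_mul_divergence_le hw hψ hψc hψ1) _).trans ?_
    refine lintegral_norm_gradient_le_of_shell_bound hd hw hK hb hc hC hδ hR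
      (fun k hk hkδ hkR => ?_) he
    refine (mul_le_mul_right ?_ _).trans (H k hk hkδ)
    refine lintegral_shell_mollify_le (ρ n) hv hvM hK.measurableSet hK'.measurableSet
      (fun x hx t ht => ?_) k R
    refine Metric.mem_cthickening_of_dist_le _ x _ _ hx ?_
    have : R / (n + 1) ≤ R := div_le_self hR.le (by linarith [n.cast_nonneg (α := ℝ)])
    simpa using ht.le.trans this
  have hlim := tendsto_integral_mollify_mul hvM hvI
    ((continuous_divergence hψ).integrable_of_hasCompactSupport (hasCompactSupport_divergence hψc))
    (ρ := ρ) (tendsto_const_div_atTop_nhds_zero_nat R |>.comp (tendsto_add_atTop_nat 1) |>.congr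
      fun n => by simp [ρ]) (fun n => by simp only [ρ]; linarith)
  exact le_of_tendsto (ENNReal.Tendsto.const_mul (ENNReal.tendsto_ofReal hlim)
    (Or.inr ENNReal.ofReal_ne_top)) (Eventually.of_forall hbound)

/-! ### Truncation and the general case -/

theorem exists_lt_lintegral_Icc {f : ℝ → ℝ≥0∞} {a : ℝ≥0∞} (ha : a < ∫⁻ s in Ioi 0, f s) :
    ∃ τ T, 0 < τ ∧ 0 < T ∧ a < ∫⁻ s in Icc τ T, f s := by
  set A : ℕ → Set ℝ := fun n => Icc ((n : ℝ) + 1)⁻¹ (n + 1)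
  have hA : Monotone A := fun m n hmn => by
    have : (m : ℝ) ≤ n := by exact_mod_cast hmn
    exact Icc_subset_Icc (by gcongr) (by gcongr)
  have hU : ⋃ n, A n = Ioi 0 := by
    ext s
    simp only [mem_iUnion, mem_Ioi, A]
    refine ⟨fun ⟨n, hn⟩ => (by positivity : (0 : ℝ) < ((n : ℝ) + 1)⁻¹).trans_le hn.1, fun hs => ?_⟩
    obtain ⟨n, hn⟩ := exists_nat_ge (max s s⁻¹)
    refine ⟨n, inv_le_of_inv_le₀ hs ?_, ?_⟩
    · linarith [le_max_right s s⁻¹]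
    · linarith [le_max_left s s⁻¹]
  rw [← hU, setLIntegral_iUnion_of_directed _ hA.directed_le] at ha
  obtain ⟨n, hn⟩ := lt_iSup_iff.1 ha
  exact ⟨_, _, by positivity, by positivity, hn⟩

/-- Truncation of a real number to the interval `[-M, M]`. -/
def truncation (M s : ℝ) : ℝ := max (-M) (min s M)

theorem measurable_truncation (M : ℝ) : Measurable (truncation M) := by
  unfold truncation; fun_prop

theorem abs_truncation_le {M : ℝ} (hM : 0 ≤ M) (s : ℝ) : |truncation M s| ≤ M :=
  abs_le.2 ⟨le_max_left _ _, max_le (by linarith) (min_le_right _ _)⟩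

theorem truncation_eq_self {M s : ℝ} (h : |s| ≤ M) : truncation M s = s := by
  rw [abs_le] at h
  rw [truncation, min_eq_left h.2, max_eq_right h.1]

theorem abs_truncation_sub_le (M s t : ℝ) : |truncation M s - truncation M t| ≤ |s - t| := by
  refine (abs_max_sub_max_le_max _ _ _ _).trans ?_
  rw [sub_self, abs_zero, max_eq_right (abs_nonneg _)]
  refine (abs_min_sub_min_le_max _ _ _ _).trans ?_
  rw [sub_self, abs_zero, max_eq_left (abs_nonneg _)]

theorem abs_truncation_le_abs {M : ℝ} (hM : 0 ≤ M) (s : ℝ) : |truncation M s| ≤ |s| := by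
  have h0 : truncation M 0 = 0 := truncation_eq_self (by simpa using hM)
  simpa [h0] using abs_truncation_sub_le M s 0

theorem scaledEnergy_mono_ae {d : ℕ} {φ φ' : ℝ → ℝ} {Ω : Set (EuclideanSpace ℝ (Fin d))}
    {u v : EuclideanSpace ℝ (Fin d) → ℝ} {P : EuclideanSpace ℝ (Fin d) → Prop}
    (hP : ∀ᵐ x ∂volume.restrict Ω, P x) {η : ℝ}
    (h : ∀ x y, P x → P y → φ' |v x / η - v y / η| ≤ φ |u x / η - u y / η|) :
    scaledEnergy φ' Ω η v ≤ scaledEnergy φ Ω η u := by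
  refine mul_le_mul_right (lintegral_mono_ae ?_) _
  filter_upwards [hP] with x hx
  refine lintegral_mono_ae ?_
  filter_upwards [hP] with y hy
  exact ENNReal.ofReal_le_ofReal (div_le_div_of_nonneg_right (h x y hx hy) (by positivity))

/-- If the energies are bounded by `b` for small `δ`, then so is the action of `∇u` on any
admissible test field. -/
theorem ofReal_integral_mul_divergence_le_of_isProfile {d : ℕ} (hd : 1 ≤ d) {φ : ℝ → ℝ}
    (hφ : IsProfile d φ) {Ω : Set (EuclideanSpace ℝ (Fin d))} (hΩ : IsOpen Ω)
    {u : EuclideanSpace ℝ (Fin d) → ℝ} (hu : IntegrableOn u Ω volume) {b δ : ℝ} (hb : 0 ≤ b)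
    (hδ : 0 < δ) (hE : ∀ η, 0 < η → η ≤ δ → scaledEnergy φ Ω η u ≤ ENNReal.ofReal b)
    {ψ : EuclideanSpace ℝ (Fin d) → EuclideanSpace ℝ (Fin d)} (hψ : ContDiff ℝ 1 ψ)
    (hψc : HasCompactSupport ψ) (hψΩ : tsupport ψ ⊆ Ω) (hψ1 : ∀ x, ‖ψ x‖ ≤ 1) :
    ENNReal.ofReal (∫ x in Ω, u x * divergence ψ x) ≤ ENNReal.ofReal b := by
  obtain ⟨e, he, hnorm⟩ := hφ.normalized
  set γ := sphereConst d e
  set I := ∫ t in Ioi (0 : ℝ), φ t / t ^ 2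
  have hγ : 0 ≤ γ := sphereConst_nonneg d e
  have hI : 0 < I := by
    by_contra! h
    linarith [mul_nonpos_of_nonneg_of_nonpos hγ h]
  -- Extending `φ` by the constant `φ 0` to the negative axis makes it monotone on `ℝ`, hence
  -- measurable.
  set φ' : ℝ → ℝ := fun t => φ (max t 0)
  have hmono : Monotone φ' := fun s t hst =>
    hφ.monotone (mem_Ici.2 (le_max_right s 0)) (mem_Ici.2 (le_max_right t 0))
      (max_le_max_right _ hst)
  have hφ' : ∀ t, 0 ≤ t → φ' t = φ t := fun t ht => by simp only [φ', max_eq_left ht]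
  have hIl : ENNReal.ofReal I = ∫⁻ s in Ioi (0 : ℝ), ENNReal.ofReal (φ' s / s ^ 2) := by
    rw [setLIntegral_congr_fun (g := fun s => ENNReal.ofReal (φ s / s ^ 2)) measurableSet_Ioi
      fun s hs => by rw [hφ' s (le_of_lt hs)]]
    refine ofReal_integral_eq_lintegral_ofReal ?_ ?_
    -- A non-integrable function has integral `0` by convention, which contradicts `I > 0`.
    · by_contra h
      exact hI.ne' (integral_undef h)
    · filter_upwards [ae_restrict_mem measurableSet_Ioi] with s hs
      exact div_nonneg (hφ.nonneg s (le_of_lt hs)) (sq_nonneg s)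
  obtain ⟨s₀, hs₀, hφs₀⟩ : ∃ s₀, 0 < s₀ ∧ 0 < φ' s₀ := by
    by_contra! h
    have : ENNReal.ofReal I = 0 := by
      rw [hIl]
      refine setLIntegral_eq_zero measurableSet_Ioi fun s hs => ?_
      exact ENNReal.ofReal_of_nonpos (div_nonpos_of_nonpos_of_nonneg (h s hs) (sq_nonneg s))
    exact absurd (ENNReal.ofReal_eq_zero.1 this) (not_le.2 hI)
  set u₀ := hu.aestronglyMeasurable.mk u
  have hu₀m : Measurable u₀ := hu.aestronglyMeasurable.stronglyMeasurable_mk.measurable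
  have hae : ∀ᵐ x ∂volume.restrict Ω, u x = u₀ x := hu.aestronglyMeasurable.ae_eq_mk
  have hu₀ : IntegrableOn u₀ Ω volume := hu.congr hae
  have hdiv := continuous_divergence hψ
  have hdivc := hasCompactSupport_divergence hψc
  have hbdd : ∀ M : ℝ, 0 ≤ M →
      ENNReal.ofReal (∫ x in Ω, truncation M (u₀ x) * divergence ψ x) ≤ ENNReal.ofReal b := by
    intro M hM
    -- Extension by zero gives an integrable function on the whole space, as mollification requires;
    -- the energy sees only its values on `Ω`.
    set v : EuclideanSpace ℝ (Fin d) → ℝ := Ω.indicator fun x => truncation M (u₀ x)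
    have hvm : Measurable v := ((measurable_truncation M).comp hu₀m).indicator hΩ.measurableSet
    have hvM : ∀ x, |v x| ≤ M := fun x => by
      by_cases hx : x ∈ Ω
      · simp only [v, indicator_of_mem hx]; exact abs_truncation_le hM _
      · simpa [v, indicator_of_notMem hx] using hM
    have hvI : Integrable v := by
      rw [integrable_indicator_iff hΩ.measurableSet]
      exact Integrable.mono hu₀ ((measurable_truncation M).comp hu₀m).aestronglyMeasurable
        (ae_of_all _ fun x => abs_truncation_le_abs hM _)
    have hvE : ∀ η, 0 < η → η ≤ δ → scaledEnergy φ' Ω η v ≤ ENNReal.ofReal b := by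
      intro η h0 h1
      refine le_trans ?_ (hE η h0 h1)
      refine scaledEnergy_mono_ae (P := fun x => u x = u₀ x ∧ x ∈ Ω)
        (hae.and (ae_restrict_mem hΩ.measurableSet)) fun x y hx hy => ?_
      rw [← hφ' _ (abs_nonneg (u x / η - u y / η))]
      refine hmono ?_
      rw [← sub_div, ← sub_div, abs_div, abs_div]
      refine div_le_div_of_nonneg_right ?_ (abs_nonneg η)
      simp only [v, indicator_of_mem hx.2, indicator_of_mem hy.2, hx.1, hy.1]
      exact abs_truncation_sub_le M _ _
    have hv_int : ∫ x, v x * divergence ψ x =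
        ∫ x in Ω, truncation M (u₀ x) * divergence ψ x := by
      rw [← integral_indicator hΩ.measurableSet]
      simp only [v, indicator_mul_left]
    rw [← hv_int]
    set X := ∫ x, v x * divergence ψ x
    rcases le_or_gt X 0 with hX | hX
    · rw [ENNReal.ofReal_of_nonpos hX]; exact zero_le
    have key : ∀ c, 0 < c → c < I → c * (γ * X) ≤ b := by
      intro c hc hcI
      obtain ⟨τ, T, hτ, hT, hlt⟩ := exists_lt_lintegral_Icc
        (hIl ▸ (ENNReal.ofReal_lt_ofReal_iff hI).2 hcI)
      have := ofReal_integral_mul_divergence_le_of_scaledEnergy_le hd hmono hΩ hvm hvM hvI hb hδ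
        hvE hc hτ hT hlt.le hs₀ hφs₀ he hψ hψc hψΩ hψ1
      rw [← ENNReal.ofReal_mul (by positivity), ENNReal.ofReal_le_ofReal_iff hb, mul_assoc] at this
      exact this
    have hlim : Tendsto (fun c : ℝ => c * (γ * X)) (𝓝[<] I) (𝓝 (I * (γ * X))) :=
      ((continuous_id.mul continuous_const).tendsto I).mono_left nhdsWithin_le_nhds
    have := le_of_tendsto hlim (Filter.mem_of_superset (Ioo_mem_nhdsLT hI)
      fun c hc => key c hc.1 hc.2)
    rw [← mul_assoc, mul_comm I, hnorm, one_mul] at this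
    exact ENNReal.ofReal_le_ofReal this
  obtain ⟨B, hB⟩ := hdivc.exists_bound_of_continuous hdiv
  have hlim : Tendsto (fun n : ℕ => ∫ x in Ω, truncation n (u₀ x) * divergence ψ x) atTop
      (𝓝 (∫ x in Ω, u₀ x * divergence ψ x)) := by
    refine tendsto_integral_of_dominated_convergence (fun x => ‖u₀ x‖ * B) (fun n => ?_)
      (hu₀.norm.mul_const B) (fun n => ae_of_all _ fun x => ?_) (ae_of_all _ fun x => ?_)
    · exact (((measurable_truncation n).comp hu₀m).mul hdiv.measurable).aestronglyMeasurable
    · rw [norm_mul]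
      exact mul_le_mul (abs_truncation_le_abs n.cast_nonneg _) (hB x) (norm_nonneg _)
        (norm_nonneg _)
    · refine tendsto_const_nhds.congr' ?_
      obtain ⟨N, hN⟩ := exists_nat_ge |u₀ x|
      filter_upwards [eventually_ge_atTop N] with n hn
      rw [truncation_eq_self (hN.trans (by exact_mod_cast hn))]
  have hcongr : ∫ x in Ω, u x * divergence ψ x = ∫ x in Ω, u₀ x * divergence ψ x :=
    integral_congr_ae (hae.mono fun x hx => by simp only [hx])
  rw [hcongr]
  exact le_of_tendsto (ENNReal.tendsto_ofReal hlim)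
    (Eventually.of_forall fun n => hbdd n n.cast_nonneg)

theorem mainTheorem8 (d : ℕ) (hd : 1 ≤ d) (φ : ℝ → ℝ) (hφ : IsProfile d φ)
    (Ω : Set (EuclideanSpace ℝ (Fin d))) (hΩ : IsOpen Ω)
    (hΩ' : (Bornology.IsBounded Ω ∧ HasSmoothBoundary Ω) ∨ Ω = Set.univ)
    (u : EuclideanSpace ℝ (Fin d) → ℝ) (hu : IntegrableOn u Ω volume) :
    totalVariation Ω u ≤ limsup (fun δ : ℝ => scaledEnergy φ Ω δ u) (𝓝[>] 0) := by
  refine iSup_le fun ψ => iSup_le fun hψ => iSup_le fun hψc => iSup_le fun hψΩ =>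
    iSup_le fun hψ1 => ?_
  refine le_of_forall_gt_imp_ge_of_dense fun a ha => ?_
  rcases eq_or_ne a ⊤ with rfl | hatop
  · exact le_top
  -- Any `a` above the upper limit bounds the energy at every scale in some `(0, δ]`, which is what
  -- the averaging over scales needs.
  obtain ⟨δ, hδ, hE⟩ := (mem_nhdsGT_iff_exists_Ioc_subset).1 (eventually_lt_of_limsup_lt ha)
  rw [← ENNReal.ofReal_toReal hatop]
  refine ofReal_integral_mul_divergence_le_of_isProfile hd hφ hΩ hu ENNReal.toReal_nonneg hδ
    (fun η h0 h1 => ?_) hψ hψc hψΩ hψ1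
  rw [ENNReal.ofReal_toReal hatop]
  exact (hE ⟨h0, h1⟩ : scaledEnergy φ Ω η u < a).le
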